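/- Let $k$ be an algebraically closed field of arbitrary characteristic, and let $\mathcal N\subset\mathfrak{sl}_3(k)$ be the nilpotent cone, i.e. the set of nilpotent $3\times 3$ matrices of trace zero. For $r\ge 1$ let $$C_r(\mathcal N)=\{(v_1,\dots,v_r)\in\mathcal N^r \mid [v_i,v_j]=0 \text{ for all } 1\le i\le j\le r\}.$$ Then for every $r\ge 1$ the set $C_r(\mathcal N)$ is a Zariski-closed, irreducible subset of the affine space $\mathfrak{sl}_3(k)^r$, and its dimension is $2r+4$. -/

import Mathlib

/-- The ring of polynomial functions on a finite-dimensional `k`-vector space `W`, regarded as an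
affine space: the `k`-algebra of functions on `W` generated by the linear functionals. -/
def affinePolynomialFunctions (k W : Type*) [Field k] [AddCommGroup W] [Module k W] :
    Subalgebra k (W → k) :=
  Algebra.adjoin k (Set.range fun φ : Module.Dual k W => (φ : W → k))

/-- The set of common zeros in `W` of a set `S` of functions. -/
def commonZeros {k W : Type*} [Field k] (S : Set (W → k)) : Set W :=
  {w | ∀ f ∈ S, f w = 0}

/-- The Zariski topology on a finite-dimensional `k`-vector space `W`: the closed sets are the
common zeros of sets of polynomial functions. -/
@[reducible] def zariskiTopology (k W : Type*) [Field k] [AddCommGroup W] [Module k W] :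
    TopologicalSpace W :=
  TopologicalSpace.ofClosed
    {Z | ∃ S : Set (W → k), S ⊆ affinePolynomialFunctions k W ∧ Z = commonZeros S}
    ⟨{1}, by simp, by ext w; simp [commonZeros]⟩
    (by
      intro A hA
      refine ⟨{f | f ∈ affinePolynomialFunctions k W ∧ ∃ Z ∈ A, ∀ w ∈ Z, f w = 0},
        fun f hf => hf.1, ?_⟩
      ext w
      constructor
      · rintro hw f ⟨-, Z, hZ, hf⟩
        exact hf w (hw Z hZ)
      · intro hw Z hZ
        obtain ⟨S, hS, rfl⟩ := hA hZ
        exact fun f hf => hw f ⟨hS hf, _, hZ, fun w hw => hw f hf⟩)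
    (by
      rintro _ ⟨S, hS, rfl⟩ _ ⟨T, hT, rfl⟩
      refine ⟨{h | ∃ f ∈ S, ∃ g ∈ T, h = f * g}, ?_, ?_⟩
      · rintro _ ⟨f, hf, g, hg, rfl⟩
        exact mul_mem (hS hf) (hT hg)
      · ext w
        constructor
        · rintro (hw | hw) _ ⟨f, hf, g, hg, rfl⟩
          · simp [hw f hf]
          · simp [hw g hg]
        · intro hw
          by_contra hcon
          simp only [commonZeros, Set.mem_union, Set.mem_ofPred_eq, not_or, not_forall] at hcon
          obtain ⟨⟨f, hf, hfw⟩, ⟨g, hg, hgw⟩⟩ := hcon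
          exact mul_ne_zero hfw hgw (hw _ ⟨f, hf, g, hg, rfl⟩))

/-- A subset of `W` is an algebraic set (a closed subvariety) if it is Zariski closed. -/
def IsZariskiClosed (k : Type*) {W : Type*} [Field k] [AddCommGroup W] [Module k W]
    (Z : Set W) : Prop :=
  @IsClosed W (zariskiTopology k W) Z

/-- Irreducibility of a subset of `W` (in particular it is non-empty) in the Zariski topology. -/
def IsZariskiIrreducible (k : Type*) {W : Type*} [Field k] [AddCommGroup W] [Module k W]
    (Z : Set W) : Prop :=
  @IsIrreducible W (zariskiTopology k W) Z

/-- The dimension of a subset `Z` of `W`: the supremum of the lengths of chains of irreducible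
closed subsets of `Z`, where `Z` carries the subspace topology of the Zariski topology. -/
noncomputable def zariskiDim (k : Type*) {W : Type*} [Field k] [AddCommGroup W] [Module k W]
    (Z : Set W) : WithBot ℕ∞ :=
  letI : TopologicalSpace W := zariskiTopology k W
  topologicalKrullDim Z

/-- The commuting variety `C_r(V)` over a subset `V` of a Lie algebra: the `r`-tuples of pairwise
commuting elements of `V`. -/
def commutingVariety {L : Type*} [LieRing L] (V : Set L) (r : ℕ) : Set (Fin r → L) :=
  {v | (∀ i, v i ∈ V) ∧ ∀ i j, ⁅v i, v j⁆ = 0}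

/-- The nilpotent cone of `𝔰𝔩ₙ(k)`: the trace zero matrices that are nilpotent. -/
def nilpotentCone (n : ℕ) (k : Type*) [Field k] :
    Set (LieAlgebra.SpecialLinear.sl (Fin n) k) :=
  {x | IsNilpotent (x : Matrix (Fin n) (Fin n) k)}

/-! ### Polynomial functions, polynomial maps and irreducibility. -/

section PolynomialFunctions

variable {k V W X : Type*} [Field k] [AddCommGroup V] [Module k V] [AddCommGroup W] [Module k W]

/-! Commuting nilpotent matrices can be made strictly upper triangular together
(`exists_strictUpperTriangular`). Commutation then says that the superdiagonals are proportional, so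
each tuple is conjugate to `lᵢ (s E₁₂ + t E₂₃) + bᵢ E₁₃`. If `s ≠ 0` and the conjugating matrix has
an LU factorisation, its upper factor can be absorbed: `s` becomes 1 and a lower unitriangular
conjugator remains. This gives a polynomial map `bigCellMap` from affine space of dimension `2r + 4`
(`b`, `l`, `t` and three entries of the conjugator).

Any tuple lies on a polynomial curve all but finitely many of whose points are in the image, so the
image is dense (`eq_zero_of_comp_bigCellMap_eq_zero`). Density gives irreducibility and, by
comparing transcendence degrees, the upper bound on the dimension. For the lower bound, the closures
of the images of coordinate subspaces form a chain, strict by the explicit functions in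
`bigCellMap_witness`. -/

theorem isClosed_zariskiTopology_iff {Z : Set W} :
    @IsClosed W (zariskiTopology k W) Z ↔
      ∃ S : Set (W → k), S ⊆ affinePolynomialFunctions k W ∧ Z = commonZeros S := by
  let := zariskiTopology k W
  rw [← isOpen_compl_iff]
  change Zᶜᶜ ∈ _ ↔ _
  rw [compl_compl]
  rfl

theorem isClosed_zeros {f : W → k} (hf : f ∈ affinePolynomialFunctions k W) :
    @IsClosed W (zariskiTopology k W) {w | f w = 0} :=
  isClosed_zariskiTopology_iff.2 ⟨{f}, by simpa using hf, by ext; simp [commonZeros]⟩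

theorem dual_mem_affinePolynomialFunctions (φ : Module.Dual k W) :
    (φ : W → k) ∈ affinePolynomialFunctions k W :=
  Algebra.subset_adjoin ⟨φ, rfl⟩

theorem mvPolynomial_eval_mem {ι : Type*} {f : ι → W → k}
    (hf : ∀ i, f i ∈ affinePolynomialFunctions k W) (P : MvPolynomial ι k) :
    (fun w => MvPolynomial.eval (fun i => f i w) P) ∈ affinePolynomialFunctions k W := by
  induction P using MvPolynomial.induction_on with
  | C a =>
    simp only [MvPolynomial.eval_C]
    exact algebraMap_mem (affinePolynomialFunctions k W) a
  | add p q hp hq =>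
    simp only [map_add]
    exact add_mem hp hq
  | mul_X p i hp =>
    simp only [map_mul, MvPolynomial.eval_X]
    exact mul_mem hp (hf i)

/-- A map between affine spaces is polynomial if its composite with every linear functional is a
polynomial function. -/
def IsPolynomialMap (k : Type*) {V W : Type*} [Field k] [AddCommGroup V] [Module k V]
    [AddCommGroup W] [Module k W] (F : V → W) : Prop :=
  ∀ φ : Module.Dual k W, (fun v => φ (F v)) ∈ affinePolynomialFunctions k V

theorem IsPolynomialMap.comp_mem {F : V → W} (hF : IsPolynomialMap k F) {f : W → k}
    (hf : f ∈ affinePolynomialFunctions k W) :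
    (fun v => f (F v)) ∈ affinePolynomialFunctions k V := by
  induction hf using Algebra.adjoin_induction with
  | mem f hf =>
    obtain ⟨φ, rfl⟩ := hf
    exact hF φ
  | algebraMap r => exact algebraMap_mem (affinePolynomialFunctions k V) r
  | add f g _ _ hf hg => exact add_mem hf hg
  | mul f g _ _ hf hg => exact mul_mem hf hg

theorem IsPolynomialMap.comp {U : Type*} [AddCommGroup U] [Module k U] {F : V → W} {G : U → V}
    (hF : IsPolynomialMap k F) (hG : IsPolynomialMap k G) : IsPolynomialMap k (F ∘ G) :=
  fun φ => hG.comp_mem (hF φ)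

theorem LinearMap.isPolynomialMap (F : V →ₗ[k] W) : IsPolynomialMap k F :=
  fun φ => dual_mem_affinePolynomialFunctions (φ ∘ₗ F)

theorem exists_mvPolynomial_of_mem {ι : Type*} [Finite ι] {f : (ι → k) → k}
    (hf : f ∈ affinePolynomialFunctions k (ι → k)) :
    ∃ P : MvPolynomial ι k, ∀ p, f p = MvPolynomial.eval p P := by
  cases nonempty_fintype ι
  classical
  induction hf using Algebra.adjoin_induction with
  | mem f hf =>
    obtain ⟨φ, rfl⟩ := hf
    refine ⟨∑ i, MvPolynomial.C (φ (Pi.single i 1)) * MvPolynomial.X i, fun p => ?_⟩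
    beta_reduce
    rw [LinearMap.pi_apply_eq_sum_univ φ p]
    simp only [map_sum, map_mul, MvPolynomial.eval_C, MvPolynomial.eval_X, smul_eq_mul]
    refine Finset.sum_congr rfl fun i _ => ?_
    rw [mul_comm]
    congr 2
    ext j
    simp [Pi.single_apply, eq_comm]
  | algebraMap r => exact ⟨MvPolynomial.C r, fun p => by simp⟩
  | add f g _ _ hf hg =>
    obtain ⟨P, hP⟩ := hf
    obtain ⟨Q, hQ⟩ := hg
    exact ⟨P + Q, fun p => by simp [hP, hQ]⟩
  | mul f g _ _ hf hg =>
    obtain ⟨P, hP⟩ := hf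
    obtain ⟨Q, hQ⟩ := hg
    exact ⟨P * Q, fun p => by simp [hP, hQ]⟩

theorem exists_polynomial_of_mem {f : k → k} (hf : f ∈ affinePolynomialFunctions k k) :
    ∃ P : Polynomial k, ∀ p, f p = P.eval p := by
  induction hf using Algebra.adjoin_induction with
  | mem f hf =>
    obtain ⟨φ, rfl⟩ := hf
    refine ⟨Polynomial.C (φ 1) * Polynomial.X, fun p => ?_⟩
    have h := φ.map_smul p 1
    rw [smul_eq_mul, smul_eq_mul, mul_one] at h
    rw [Polynomial.eval_mul, Polynomial.eval_C, Polynomial.eval_X, mul_comm]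
    exact h
  | algebraMap r => exact ⟨Polynomial.C r, fun p => by simp⟩
  | add f g _ _ hf hg =>
    obtain ⟨P, hP⟩ := hf
    obtain ⟨Q, hQ⟩ := hg
    exact ⟨P + Q, fun p => by simp [hP, hQ]⟩
  | mul f g _ _ hf hg =>
    obtain ⟨P, hP⟩ := hf
    obtain ⟨Q, hQ⟩ := hg
    exact ⟨P * Q, fun p => by simp [hP, hQ]⟩

/-- Stating this for an inducing map covers both subsets of `W` and subsets of a subspace `Z`, where
the dimension is computed. -/
theorem isIrreducible_iff_of_isInducing [TopologicalSpace X] {e : X → W}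
    (he : @Topology.IsInducing X W _ (zariskiTopology k W) e) {Y : Set X} :
    IsIrreducible Y ↔ Y.Nonempty ∧ ∀ f ∈ affinePolynomialFunctions k W,
      ∀ g ∈ affinePolynomialFunctions k W, (∀ y ∈ Y, f (e y) * g (e y) = 0) →
        (∀ y ∈ Y, f (e y) = 0) ∨ (∀ y ∈ Y, g (e y) = 0) := by
  let := zariskiTopology k W
  refine and_congr_right fun _ => ?_
  rw [isPreirreducible_iff_isClosed_union_isClosed]
  constructor
  · intro h f hf g hg hfg
    refine h {y | f (e y) = 0} {y | g (e y) = 0} ((isClosed_zeros hf).preimage he.continuous)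
      ((isClosed_zeros hg).preimage he.continuous) fun y hy => ?_
    simpa using hfg y hy
  · intro h z₁ z₂ h₁ h₂ hY
    obtain ⟨c₁, hc₁, rfl⟩ := he.isClosed_iff.1 h₁
    obtain ⟨c₂, hc₂, rfl⟩ := he.isClosed_iff.1 h₂
    obtain ⟨S₁, hS₁, rfl⟩ := isClosed_zariskiTopology_iff.1 hc₁
    obtain ⟨S₂, hS₂, rfl⟩ := isClosed_zariskiTopology_iff.1 hc₂
    by_contra! hcon
    obtain ⟨⟨y₁, hy₁, hn₁⟩, ⟨y₂, hy₂, hn₂⟩⟩ := And.imp Set.not_subset.1 Set.not_subset.1 hcon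
    simp only [Set.mem_preimage, commonZeros, Set.mem_ofPred_eq, not_forall] at hn₁ hn₂
    obtain ⟨f, hf, hfy⟩ := hn₁
    obtain ⟨g, hg, hgy⟩ := hn₂
    have hfg : ∀ y ∈ Y, f (e y) * g (e y) = 0 := fun y hy => by
      rcases hY hy with h | h
      · rw [h f hf, zero_mul]
      · rw [h g hg, mul_zero]
    rcases h f (hS₁ hf) g (hS₂ hg) hfg with h | h
    · exact hfy (h _ hy₁)
    · exact hgy (h _ hy₂)

/-- A set containing the image of an affine space under a polynomial map as a dense subset is
irreducible. -/
theorem isIrreducible_of_dominant [Infinite k] [TopologicalSpace X] {e : X → W}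
    (he : @Topology.IsInducing X W _ (zariskiTopology k W) e) {Y : Set X} {ι : Type*} [Finite ι]
    {F : (ι → k) → X} (hF : IsPolynomialMap k (e ∘ F)) (hFY : ∀ p, F p ∈ Y)
    (hd : ∀ f ∈ affinePolynomialFunctions k W, (∀ p, f (e (F p)) = 0) → ∀ y ∈ Y, f (e y) = 0) :
    IsIrreducible Y := by
  refine (isIrreducible_iff_of_isInducing he).2 ⟨⟨_, hFY 0⟩, fun f hf g hg hfg => ?_⟩
  obtain ⟨P, hP⟩ := exists_mvPolynomial_of_mem (hF.comp_mem hf)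
  obtain ⟨Q, hQ⟩ := exists_mvPolynomial_of_mem (hF.comp_mem hg)
  have hPQ : P * Q = 0 := MvPolynomial.funext fun p => by
    simpa [← hP, ← hQ] using hfg _ (hFY p)
  rcases mul_eq_zero.1 hPQ with rfl | rfl
  · exact Or.inl (hd f hf fun p => by simpa using hP p)
  · exact Or.inr (hd g hg fun p => by simpa using hQ p)

/-! ### Bounds for the dimension. -/

/-- If `f` is independent on `Y₁`, a proper closed subset of the irreducible set `Y₂`, then adding
an equation of `Y₁` gives an independent family on `Y₂`. -/
theorem independent_cons {m : ℕ} {f : Fin m → W → k} {h : W → k} {Y₁ Y₂ : Set W}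
    (hf : ∀ i, f i ∈ affinePolynomialFunctions k W) (hh : h ∈ affinePolynomialFunctions k W)
    (hY : Y₁ ⊆ Y₂) (h₁ : ∀ w ∈ Y₁, h w = 0) (h₂ : ¬ ∀ w ∈ Y₂, h w = 0)
    (hirr : ∀ f ∈ affinePolynomialFunctions k W, ∀ g ∈ affinePolynomialFunctions k W,
      (∀ y ∈ Y₂, f y * g y = 0) → (∀ y ∈ Y₂, f y = 0) ∨ (∀ y ∈ Y₂, g y = 0))
    (hind : ∀ P : MvPolynomial (Fin m) k,
      (∀ w ∈ Y₁, MvPolynomial.eval (fun i => f i w) P = 0) → P = 0)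
    (P : MvPolynomial (Fin (m + 1)) k)
    (hP : ∀ w ∈ Y₂, MvPolynomial.eval (fun i => (Fin.cons h f : Fin (m + 1) → W → k) i w) P = 0) :
    P = 0 := by
  have hmem' (Q : Polynomial (MvPolynomial (Fin m) k)) :
      (fun w => (Q.map (MvPolynomial.eval fun i => f i w)).eval (h w)) ∈
        affinePolynomialFunctions k W := by
    induction Q using Polynomial.induction_on' with
    | add p q hp hq =>
      simp only [Polynomial.map_add, Polynomial.eval_add]
      exact add_mem hp hq
    | monomial n a =>
      simp only [Polynomial.map_monomial, Polynomial.eval_monomial]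
      exact mul_mem (mvPolynomial_eval_mem hf a) (pow_mem hh n)
  -- Read a relation as a polynomial in `h` over polynomials in `f`. On `Y₁`, where `h = 0`, only
  -- the constant term survives, so it is zero by independence. A factor `h` then splits off and
  -- cancels by irreducibility of `Y₂`, which lowers the degree.
  have key (d : ℕ) : ∀ Q : Polynomial (MvPolynomial (Fin m) k), Q.natDegree ≤ d →
      (∀ w ∈ Y₂, (Q.map (MvPolynomial.eval fun i => f i w)).eval (h w) = 0) → Q = 0 := by
    induction d with
    | zero =>
      intro Q hQd hQ
      rw [Polynomial.eq_C_of_natDegree_le_zero hQd] at hQ ⊢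
      rw [hind (Q.coeff 0) fun w hw => by simpa using hQ w (hY hw), map_zero]
    | succ d ih =>
      intro Q hQd hQ
      have h0 : Q.coeff 0 = 0 := hind _ fun w hw => by
        have := hQ w (hY hw)
        rwa [h₁ w hw, ← Polynomial.coeff_zero_eq_eval_zero, Polynomial.coeff_map] at this
      have hQX : Q.divX * Polynomial.X = Q := by
        simpa [h0] using Q.divX_mul_X_add
      have hdiv : Q.divX = 0 := by
        refine ih _ (by rw [Polynomial.natDegree_divX_eq_natDegree_tsub_one]; lia) ?_
        refine (hirr _ (hmem' _) _ hh fun w hw => ?_).resolve_right h₂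
        have := hQ w hw
        rwa [← hQX, Polynomial.map_mul, Polynomial.map_X, Polynomial.eval_mul_X] at this
      rw [← hQX, hdiv, zero_mul]
  refine (map_eq_zero_iff _ (MvPolynomial.finSuccEquiv k m).injective).1 ?_
  refine key _ _ le_rfl fun w hw => ?_
  rw [← MvPolynomial.eval_eq_eval_mv_eval', ← hP w hw]
  congr 2
  ext i
  cases i using Fin.cases <;> simp

/-- Each step up the chain contributes one function: an equation of the smaller set that is not
identically zero on the larger one. -/
theorem exists_independent_of_chain [TopologicalSpace X] {e : X → W}
    (he : @Topology.IsInducing X W _ (zariskiTopology k W) e) (m : ℕ)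
    (p : LTSeries (TopologicalSpace.IrreducibleCloseds X)) (hp : p.length = m) :
    ∃ f : Fin m → W → k, (∀ i, f i ∈ affinePolynomialFunctions k W) ∧
      ∀ P : MvPolynomial (Fin m) k,
        (∀ x ∈ p.last, MvPolynomial.eval (fun i => f i (e x)) P = 0) → P = 0 := by
  let := zariskiTopology k W
  induction m generalizing p with
  | zero =>
    refine ⟨0, fun i => i.elim0, fun P hP => ?_⟩
    obtain ⟨x, hx⟩ := p.last.isIrreducible'.nonempty
    rw [MvPolynomial.eq_C_of_isEmpty P] at hP ⊢
    simpa using hP x hx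
  | succ m ih =>
    obtain ⟨f, hf, hind⟩ := ih p.eraseLast (by simp [hp])
    have hlt : p.eraseLast.last < p.last := p.eraseLast_last_rel_last (by lia)
    obtain ⟨c, hc, hce⟩ := he.isClosed_iff.1 p.eraseLast.last.isClosed'
    obtain ⟨S, hS, rfl⟩ := isClosed_zariskiTopology_iff.1 hc
    obtain ⟨x, hx, hxn⟩ := Set.exists_of_ssubset (SetLike.coe_ssubset_coe.2 hlt)
    have hxn' : x ∉ e ⁻¹' commonZeros S := by rwa [hce]
    simp only [Set.mem_preimage, commonZeros, Set.mem_ofPred_eq, not_forall] at hxn'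
    obtain ⟨h, hhS, hhx⟩ := hxn'
    have h₁ : ∀ y ∈ p.eraseLast.last, h (e y) = 0 := fun y hy => by
      have hy' : y ∈ e ⁻¹' commonZeros S := by rwa [hce]
      exact hy' h hhS
    refine ⟨Fin.cons h f, fun i => ?_, fun P hP => ?_⟩
    · cases i using Fin.cases
      · exact hS hhS
      · exact hf _
    · refine independent_cons (Y₁ := e '' p.eraseLast.last) (Y₂ := e '' p.last) hf (hS hhS)
        (Set.image_mono hlt.le) (by simpa using h₁) ?_ ?_ (by simpa using hind) P (by simpa using hP)
      · simp only [Set.forall_mem_image]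
        exact fun H => hhx (H hx)
      · simp only [Set.forall_mem_image]
        exact ((isIrreducible_iff_of_isInducing he).1 p.last.isIrreducible').2

/-- Functions independent on a subset of `Z` stay independent after pullback along `F`, by density.
A chain of length `m` thus yields `m` algebraically independent polynomials in `n` variables. -/
theorem zariskiDim_le_of_dominant [Infinite k] {Z : Set W} {n : ℕ} {F : (Fin n → k) → W}
    (hF : IsPolynomialMap k F)
    (hd : ∀ f ∈ affinePolynomialFunctions k W, (∀ p, f (F p) = 0) → ∀ w ∈ Z, f w = 0) :
    zariskiDim k Z ≤ (n : WithBot ℕ∞) := by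
  let := zariskiTopology k W
  refine iSup_le fun p => ?_
  obtain ⟨f, hf, hind⟩ := exists_independent_of_chain (k := k) (W := W) (e := (Subtype.val : Z → W))
    Topology.IsInducing.subtypeVal _ p rfl
  choose P hP using fun i => exists_mvPolynomial_of_mem (hF.comp_mem (hf i))
  have halg : AlgebraicIndependent k P := by
    rw [algebraicIndependent_iff]
    intro Q hQ
    refine hind Q fun x _ => ?_
    refine hd (fun w => MvPolynomial.eval (fun i => f i w) Q) ?_ (fun q => ?_) x x.2
    · exact mvPolynomial_eval_mem hf Q
    · simp only [hP]
      have := congrArg (MvPolynomial.eval q) hQ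
      rw [map_zero] at this
      rw [← this, ← MvPolynomial.coe_aeval_eq_eval, ← MvPolynomial.coe_aeval_eq_eval]
      change _ = ((MvPolynomial.aeval q).comp (MvPolynomial.aeval P)) Q
      rw [MvPolynomial.comp_aeval]
      rfl
  have := halg.lift_cardinalMk_le_trdeg
  rw [MvPolynomial.trdeg_of_isDomain] at this
  simp only [Cardinal.mk_fin, Cardinal.lift_natCast, Nat.cast_le] at this
  exact_mod_cast this

theorem le_zariskiDim_of_witnesses [Infinite k] {Z : Set W} {n : ℕ} {F : (Fin n → k) → W}
    (hF : IsPolynomialMap k F) (hFZ : ∀ p, F p ∈ Z)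
    (hw : ∀ j : Fin n, ∃ f ∈ affinePolynomialFunctions k W,
      (∀ p : Fin n → k, (∀ i, j ≤ i → p i = 0) → f (F p) = 0) ∧
      ∃ p : Fin n → k, (∀ i, j < i → p i = 0) ∧ f (F p) ≠ 0) :
    (n : WithBot ℕ∞) ≤ zariskiDim k Z := by
  let := zariskiTopology k W
  let π (j : ℕ) : (Fin n → k) →ₗ[k] (Fin n → k) :=
    LinearMap.pi fun i => if (i : ℕ) < j then LinearMap.proj i else 0
  have hπ (j : ℕ) (p) (i : Fin n) : π j p i = if (i : ℕ) < j then p i else 0 := by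
    simp only [π, LinearMap.pi_apply]
    split_ifs <;> simp
  have hππ {a b : ℕ} (hab : a ≤ b) (p) : π b (π a p) = π a p := by
    ext i
    simp only [hπ]
    split_ifs <;> first | rfl | lia
  -- The closure in `Z` of the image of the subspace where all coordinates of index at least `j`
  -- vanish.
  let Y (j : ℕ) : TopologicalSpace.IrreducibleCloseds Z :=
    { carrier := Subtype.val ⁻¹' commonZeros
        {f | f ∈ affinePolynomialFunctions k W ∧ ∀ p, f (F (π j p)) = 0}
      isIrreducible' := by
        refine isIrreducible_of_dominant (k := k) (W := W) (e := (Subtype.val : Z → W))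
          (F := fun p => ⟨F (π j p), hFZ _⟩)
          Topology.IsInducing.subtypeVal (hF.comp (π j).isPolynomialMap) ?_ ?_
        · exact fun p f hf => hf.2 p
        · exact fun f hf hf0 y hy => hy f ⟨hf, hf0⟩
      isClosed' := IsClosed.preimage continuous_subtype_val
        (isClosed_zariskiTopology_iff.2 ⟨_, fun f hf => hf.1, rfl⟩) }
  refine Order.le_krullDim_iff.2 ⟨{ length := n, toFun := fun j => Y j, step := fun j => ?_ }, rfl⟩
  change Y (j : ℕ) < Y ((j : ℕ) + 1)
  refine lt_of_le_of_ne (fun y hy f hf => hy f ⟨hf.1, fun p => ?_⟩) fun heq => ?_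
  · rw [← hππ (Nat.le_succ (j : ℕ)) p]
    exact hf.2 _
  · obtain ⟨f, hf, hf0, p, hp, hfp⟩ := hw j
    have hpp : π ((j : ℕ) + 1) p = p := by
      ext i
      rw [hπ]
      split_ifs with h
      · rfl
      · exact (hp i (by simp only [Fin.lt_def]; lia)).symm
    have hmem : (⟨F p, hFZ p⟩ : Z) ∈ Y ((j : ℕ) + 1) := fun g hg => by
      have := hg.2 p
      rwa [hpp] at this
    rw [← heq] at hmem
    exact hfp (hmem f ⟨hf, fun q => hf0 _ fun i hi => by
      rw [hπ, if_neg (by simp only [Fin.le_def] at hi; lia)]⟩)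

end PolynomialFunctions

/-! ### Equations of the commuting variety. -/

section CommutingNilpotent

open LieAlgebra.SpecialLinear

attribute [local instance] LieRing.ofAssociativeRing

variable {k : Type*} [Field k]

section Functions

variable {V : Type*} [AddCommGroup V] [Module k V]

theorem entry_mem_affinePolynomialFunctions {r : ℕ} {n : Type*} [Fintype n] [DecidableEq n]
    (i : Fin r) (a b : n) :
    (fun w : Fin r → sl n k => (w i : Matrix n n k) a b) ∈
      affinePolynomialFunctions k (Fin r → sl n k) :=
  dual_mem_affinePolynomialFunctions
    ((Matrix.entryLinearMap k k a b ∘ₗ (sl n k).toSubmodule.subtype) ∘ₗ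
      LinearMap.proj (R := k) (φ := fun _ : Fin r => sl n k) i)

theorem const_mem_affinePolynomialFunctions (c : k) :
    (fun _ : V => c) ∈ affinePolynomialFunctions k V :=
  algebraMap_mem (affinePolynomialFunctions k V) c

theorem matrix_mul_mem_affinePolynomialFunctions {n : Type*} [Fintype n] {M N : V → Matrix n n k}
    (hM : ∀ a b, (fun v => M v a b) ∈ affinePolynomialFunctions k V)
    (hN : ∀ a b, (fun v => N v a b) ∈ affinePolynomialFunctions k V) (a b : n) :
    (fun v => (M v * N v) a b) ∈ affinePolynomialFunctions k V := by
  have : (fun v => (M v * N v) a b) = ∑ c, (fun v => M v a c) * (fun v => N v c b) := by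
    ext v
    simp [Matrix.mul_apply]
  rw [this]
  exact sum_mem fun c _ => mul_mem (hM a c) (hN c b)

theorem isPolynomialMap_sl_of_entries {r : ℕ} {n : Type*} [Fintype n] [DecidableEq n]
    {F : V → Fin r → sl n k}
    (hF : ∀ i a b, (fun v => (F v i : Matrix n n k) a b) ∈ affinePolynomialFunctions k V) :
    IsPolynomialMap k F := by
  intro φ
  -- Extended to all matrices, a functional is a linear combination of entries.
  choose Φ hΦ using fun i => (φ ∘ₗ LinearMap.single k (fun _ : Fin r => sl n k) i).exists_extend
    (p := (sl n k).toSubmodule)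
  have h : (fun v => φ (F v)) = ∑ i, ∑ a, ∑ b,
      (fun v => (F v i : Matrix n n k) a b) * fun _ => Φ i (Matrix.single a b 1) := by
    ext v
    have h₁ : φ (F v) = ∑ i, Φ i (F v i) := by
      conv_lhs => rw [← Finset.univ_sum_single (F v), map_sum]
      exact Finset.sum_congr rfl fun i _ => (LinearMap.congr_fun (hΦ i) (F v i)).symm
    rw [h₁]
    simp only [Finset.sum_apply, Pi.mul_apply]
    refine Finset.sum_congr rfl fun i _ => ?_
    conv_lhs => rw [Matrix.matrix_eq_sum_single (F v i : Matrix n n k), map_sum]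
    refine Finset.sum_congr rfl fun a _ => ?_
    rw [map_sum]
    refine Finset.sum_congr rfl fun b _ => ?_
    rw [← smul_eq_mul, ← map_smul, Matrix.smul_single, smul_eq_mul, mul_one]
  rw [h]
  exact sum_mem fun i _ => sum_mem fun a _ => sum_mem fun b _ =>
    mul_mem (hF i a b) (const_mem_affinePolynomialFunctions _)

end Functions

/-- A nilpotent matrix over a field has characteristic polynomial `X ^ n`, so Cayley–Hamilton bounds
the exponent and nilpotency becomes a polynomial condition. -/
theorem mem_commutingVariety_nilpotentCone_iff {n r : ℕ} {v : Fin r → sl (Fin n) k} :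
    v ∈ commutingVariety (nilpotentCone n k) r ↔
      (∀ i, (v i : Matrix (Fin n) (Fin n) k) ^ n = 0) ∧
      ∀ i j, (v i : Matrix (Fin n) (Fin n) k) * v j = v j * v i := by
  refine and_congr (forall_congr' fun i => ⟨fun h => ?_, fun h => ⟨n, h⟩⟩)
    (forall_congr' fun i => forall_congr' fun j => ?_)
  · have h₁ := (Matrix.isNilpotent_charpoly_sub_pow_of_isNilpotent h).eq_zero
    rw [sub_eq_zero, Fintype.card_fin] at h₁
    simpa [h₁] using Matrix.aeval_self_charpoly (v i : Matrix (Fin n) (Fin n) k)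
  · rw [← Subtype.coe_inj, sl_bracket]
    exact sub_eq_zero

theorem isZariskiClosed_commutingVariety_nilpotentCone (n r : ℕ) :
    IsZariskiClosed k (commutingVariety (nilpotentCone n k) r) := by
  have hpow (i : Fin r) (m : ℕ) (a b : Fin n) :
      (fun w : Fin r → sl (Fin n) k => ((w i : Matrix (Fin n) (Fin n) k) ^ m) a b) ∈
        affinePolynomialFunctions k (Fin r → sl (Fin n) k) := by
    induction m generalizing a b with
    | zero =>
      simp only [pow_zero]
      exact const_mem_affinePolynomialFunctions _
    | succ m ih =>
      simp only [pow_succ]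
      exact matrix_mul_mem_affinePolynomialFunctions ih
        (entry_mem_affinePolynomialFunctions i) a b
  refine isClosed_zariskiTopology_iff.2
    ⟨{f | ∃ i a b, f = fun w => ((w i : Matrix (Fin n) (Fin n) k) ^ n) a b} ∪
      {f | ∃ i j a b, f = fun w => ((w i : Matrix (Fin n) (Fin n) k) * w j) a b -
        ((w j : Matrix (Fin n) (Fin n) k) * w i) a b}, ?_, ?_⟩
  · rintro _ (⟨i, a, b, rfl⟩ | ⟨i, j, a, b, rfl⟩)
    · exact hpow i n a b
    · exact sub_mem
        (matrix_mul_mem_affinePolynomialFunctions (entry_mem_affinePolynomialFunctions i)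
          (entry_mem_affinePolynomialFunctions j) a b)
        (matrix_mul_mem_affinePolynomialFunctions (entry_mem_affinePolynomialFunctions j)
          (entry_mem_affinePolynomialFunctions i) a b)
  · ext v
    rw [mem_commutingVariety_nilpotentCone_iff]
    constructor
    · rintro ⟨h₁, h₂⟩ _ (⟨i, a, b, rfl⟩ | ⟨i, j, a, b, rfl⟩)
      · simp [h₁ i]
      · simp [h₂ i j]
    · refine fun h => ⟨fun i => ?_, fun i j => ?_⟩
      · ext a b
        exact h _ (Or.inl ⟨i, a, b, rfl⟩)
      · ext a b
        exact sub_eq_zero.1 (h _ (Or.inr ⟨i, j, a, b, rfl⟩))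

/-! ### Simultaneous triangularisation and the normal form. -/

/-- Commuting nilpotent endomorphisms have a common null vector modulo a proper invariant
subspace. -/
theorem exists_notMem_forall_apply_mem {V ι : Type*} [AddCommGroup V] [Module k V] [Finite ι]
    {f : ι → Module.End k V} (hc : ∀ i j, f i * f j = f j * f i) (hn : ∀ i, IsNilpotent (f i))
    {U : Submodule k V} (hU : U ≠ ⊤) (hfU : ∀ i, ∀ x ∈ U, f i x ∈ U) :
    ∃ x ∉ U, ∀ i, f i x ∈ U := by
  cases nonempty_fintype ι
  classical
  suffices h : ∀ s : Finset ι, ∃ x ∉ U, ∀ i ∈ s, f i x ∈ U by simpa using h Finset.univ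
  intro s
  induction s using Finset.induction_on with
  | empty =>
    obtain ⟨x, -, hx⟩ := SetLike.exists_of_lt (lt_top_iff_ne_top.2 hU)
    exact ⟨x, hx, by simp⟩
  | insert j s _ ih =>
    obtain ⟨x, hx, hxs⟩ := ih
    have hex : ∃ m, (f j ^ m) x ∈ U := by
      obtain ⟨m, hm⟩ := hn j
      exact ⟨m, by simp [hm]⟩
    obtain ⟨m, hm⟩ : ∃ m, Nat.find hex = m + 1 := by
      refine Nat.exists_eq_succ_of_ne_zero fun h0 => hx ?_
      simpa [h0] using Nat.find_spec hex
    -- The last iterate of `x` under `f j` outside `U`. The earlier `f i` still send it into `U`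
    -- because they commute with `f j`.
    refine ⟨(f j ^ m) x, Nat.find_min hex (by lia), fun i hi => ?_⟩
    rcases Finset.mem_insert.1 hi with rfl | hi
    · have := Nat.find_spec hex
      rwa [hm, pow_succ'] at this
    · have hcomm : f i * f j ^ m = f j ^ m * f i := (Commute.pow_right (hc i j) m : _)
      have hpow : ∀ m, ∀ x ∈ U, (f j ^ m) x ∈ U := fun m => by
        induction m with
        | zero => simp
        | succ m ih => exact fun x hx => by rw [pow_succ]; exact ih _ (hfU j x hx)
      rw [← Module.End.mul_apply, hcomm]
      exact hpow m _ (hxs i hi)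

/-- The matrices `l (s E₁₂ + t E₂₃) + b E₁₃`. -/
def upperNilpotent (s t l b : k) : Matrix (Fin 3) (Fin 3) k :=
  !![0, l * s, b; 0, 0, l * t; 0, 0, 0]

/-- The lower unitriangular `3 × 3` matrices. -/
def lowerUnitriangular (x y z : k) : Matrix (Fin 3) (Fin 3) k :=
  !![1, 0, 0; x, 1, 0; y, z, 1]

/-- The inverse of `lowerUnitriangular x y z`. -/
def lowerUnitriangularInv (x y z : k) : Matrix (Fin 3) (Fin 3) k :=
  !![1, 0, 0; -x, 1, 0; x * z - y, -z, 1]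

theorem exists_strictUpperTriangular {ι : Type*} [Finite ι] {v : ι → Matrix (Fin 3) (Fin 3) k}
    (hn : ∀ i, IsNilpotent (v i)) (hc : ∀ i j, v i * v j = v j * v i) :
    ∃ g : Matrix (Fin 3) (Fin 3) k, g.det ≠ 0 ∧
      ∀ i, ∃ a b c, v i * g = g * !![0, a, b; 0, 0, c; 0, 0, 0] := by
  let f : ι → Module.End k (Fin 3 → k) := fun i => Matrix.toLinAlgEquiv' (v i)
  have hfc : ∀ i j, f i * f j = f j * f i := fun i j => by
    simp only [f, ← map_mul, hc i j]
  have hfn : ∀ i, IsNilpotent (f i) := fun i => (hn i).map Matrix.toLinAlgEquiv'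
  have htop (s : Finset (Fin 3 → k)) (hs : s.card < 3) :
      Submodule.span k (s : Set (Fin 3 → k)) ≠ ⊤ := by
    intro h
    have := finrank_span_finset_le_card (R := k) s
    rw [Set.finrank, h, finrank_top, Module.finrank_fin_fun] at this
    lia
  obtain ⟨u, hu, hfu⟩ := exists_notMem_forall_apply_mem hfc hfn (U := ⊥) bot_ne_top (by simp)
  simp only [Submodule.mem_bot] at hu hfu
  obtain ⟨v₂, hv, hfv⟩ := exists_notMem_forall_apply_mem hfc hfn (U := Submodule.span k {u})
    (by simpa using htop {u} (by simp)) (fun i x hx => by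
      obtain ⟨c, rfl⟩ := Submodule.mem_span_singleton.1 hx
      simp [hfu])
  obtain ⟨w, hw, hfw⟩ := exists_notMem_forall_apply_mem hfc hfn (U := Submodule.span k {u, v₂})
    (by
      classical
      simpa using htop {u, v₂} (Finset.card_le_two.trans_lt (by simp))) (fun i x hx => by
      obtain ⟨c, d, rfl⟩ := Submodule.mem_span_pair.1 hx
      simp only [map_add, map_smul, hfu, smul_zero, zero_add]
      exact Submodule.smul_mem _ _ (Submodule.span_mono (by simp) (hfv i)))
  have hli : LinearIndependent k ![w, v₂, u] := by
    refine linearIndependent_finCons.2 ⟨linearIndependent_finCons.2 ⟨?_, ?_⟩, ?_⟩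
    · simpa using hu
    · simpa using hv
    · simpa [Set.pair_comm] using hw
  have hli' : LinearIndependent k ![u, v₂, w] := by
    convert hli.comp ![2, 1, 0] (by decide) using 1
    ext i
    fin_cases i <;> rfl
  -- The columns form a basis adapted to the common flag.
  refine ⟨(Matrix.of ![u, v₂, w]).transpose, ?_, fun i => ?_⟩
  · rw [Matrix.det_transpose, ← isUnit_iff_ne_zero, ← Matrix.isUnit_iff_isUnit_det]
    exact Matrix.linearIndependent_rows_iff_isUnit.1 hli'
  · obtain ⟨a, ha⟩ := Submodule.mem_span_singleton.1 (hfv i)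
    obtain ⟨b, c, hbc⟩ := Submodule.mem_span_pair.1 (hfw i)
    refine ⟨a, b, c, ?_⟩
    ext p q
    have h₁ := congrFun (hfu i) p
    have h₂ := congrFun ha p
    have h₃ := congrFun hbc p
    simp only [f, Matrix.toLinAlgEquiv'_apply, Matrix.mulVec, dotProduct, Fin.sum_univ_three,
      Pi.add_apply, Pi.smul_apply, Pi.zero_apply, smul_eq_mul] at h₁ h₂ h₃
    fin_cases q
    · simpa [Matrix.mul_apply, Fin.sum_univ_three] using h₁
    · simpa [Matrix.mul_apply, Fin.sum_univ_three, mul_comm] using h₂.symm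
    · simpa [Matrix.mul_apply, Fin.sum_univ_three, mul_comm] using h₃.symm

theorem exists_common_factor {ι : Type*} {a c : ι → k} (h : ∀ i j, a i * c j = a j * c i) :
    ∃ s t : k, ∀ i, ∃ l, a i = l * s ∧ c i = l * t := by
  by_cases ha : ∃ i, a i ≠ 0
  · obtain ⟨i, hi⟩ := ha
    refine ⟨a i, c i, fun j => ⟨a j / a i, by field_simp, ?_⟩⟩
    rw [div_mul_eq_mul_div, ← h i j, mul_div_cancel_left₀ _ hi]
  · push Not at ha
    exact ⟨0, 1, fun i => ⟨c i, by simp [ha], by simp⟩⟩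

theorem exists_upperNilpotent {ι : Type*} [Finite ι] {v : ι → Matrix (Fin 3) (Fin 3) k}
    (hn : ∀ i, IsNilpotent (v i)) (hc : ∀ i j, v i * v j = v j * v i) :
    ∃ (g : Matrix (Fin 3) (Fin 3) k) (s t : k), g.det ≠ 0 ∧
      ∀ i, ∃ l b, v i * g = g * upperNilpotent s t l b := by
  obtain ⟨g, hg, h⟩ := exists_strictUpperTriangular hn hc
  choose a b c h using h
  -- Entry `(0, 2)` of the commutation relation, after cancelling `g`.
  have hac : ∀ i j, a i * c j = a j * c i := fun i j => by
    have h₁ : g * (!![0, a i, b i; 0, 0, c i; 0, 0, 0] * !![0, a j, b j; 0, 0, c j; 0, 0, 0]) =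
        g * (!![0, a j, b j; 0, 0, c j; 0, 0, 0] * !![0, a i, b i; 0, 0, c i; 0, 0, 0]) := by
      rw [← mul_assoc, ← mul_assoc, ← h i, ← h j, mul_assoc, mul_assoc, ← h i, ← h j, ← mul_assoc,
        ← mul_assoc, hc]
    have hgu : IsUnit g := (Matrix.isUnit_iff_isUnit_det g).2 hg.isUnit
    simpa [Matrix.mul_apply, Fin.sum_univ_three] using
      congrFun (congrFun (hgu.mul_left_cancel h₁) 0) 2
  obtain ⟨s, t, hst⟩ := exists_common_factor hac
  refine ⟨g, s, t, hg, fun i => ?_⟩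
  obtain ⟨l, h₁, h₂⟩ := hst i
  exact ⟨l, b i, by rw [h i, h₁, h₂, upperNilpotent]⟩

/-! ### Conjugates of the normal form and the big cell. -/

theorem lowerUnitriangularInv_mul (x y z : k) :
    lowerUnitriangularInv x y z * lowerUnitriangular x y z = 1 := by
  ext a b
  fin_cases a <;> fin_cases b <;>
    simp [lowerUnitriangularInv, lowerUnitriangular, Matrix.mul_apply, Fin.sum_univ_three]
  ring

theorem upperNilpotent_pow (s t l b : k) : upperNilpotent s t l b ^ 3 = 0 := by
  ext p q
  fin_cases p <;> fin_cases q <;>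
    simp [upperNilpotent, pow_succ, Matrix.mul_apply, Fin.sum_univ_three]

theorem upperNilpotent_comm (s t l b l' b' : k) :
    upperNilpotent s t l b * upperNilpotent s t l' b' =
      upperNilpotent s t l' b' * upperNilpotent s t l b := by
  ext p q
  fin_cases p <;> fin_cases q <;> simp [upperNilpotent]
  ring

/-- The scalar `c` lets `h` be an inverse or an adjugate; the latter needs no invertibility. -/
theorem trace_conj_upperNilpotent {g h : Matrix (Fin 3) (Fin 3) k} {c : k} (hgh : h * g = c • 1)
    (s t l b : k) : (g * upperNilpotent s t l b * h).trace = 0 := by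
  rw [Matrix.trace_mul_comm, ← mul_assoc, hgh, smul_mul_assoc, one_mul, Matrix.trace_smul]
  simp [upperNilpotent, Matrix.trace, Fin.sum_univ_three]

/-- An upper triangular conjugate of `upperNilpotent` is of the same shape. -/
theorem upperTriangular_conj_upperNilpotent (p q u e w f s t l b : k) :
    !![p, q, u; 0, e, w; 0, 0, f] * upperNilpotent s t l b *
        !![p, q, u; 0, e, w; 0, 0, f].adjugate =
      !![0, p ^ 2 * f * (l * s), p * (p * e * b + q * e * (l * t) - p * w * (l * s));
        0, 0, e ^ 2 * p * (l * t); 0, 0, 0] := by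
  rw [Matrix.adjugate_fin_three_of]
  ext i j
  fin_cases i <;> fin_cases j <;>
    simp [upperNilpotent, Matrix.mul_apply, Fin.sum_univ_three] <;> ring

theorem adjugate_lowerUnitriangular (x y z : k) :
    (lowerUnitriangular x y z).adjugate = lowerUnitriangularInv x y z := by
  rw [lowerUnitriangular, Matrix.adjugate_fin_three_of, lowerUnitriangularInv]
  ext i j
  fin_cases i <;> fin_cases j <;> simp

/-- Gaussian elimination without pivoting: the pivots are quotients of successive leading minors. -/
theorem exists_lower_mul_upper {h : Matrix (Fin 3) (Fin 3) k} (h₀ : h 0 0 ≠ 0)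
    (h₁ : h 0 0 * h 1 1 - h 0 1 * h 1 0 ≠ 0) (hdet : h.det ≠ 0) :
    ∃ x y z p q u e w f, p ≠ 0 ∧ f ≠ 0 ∧
      h = lowerUnitriangular x y z * !![p, q, u; 0, e, w; 0, 0, f] := by
  have key : h = lowerUnitriangular (h 1 0 / h 0 0) (h 2 0 / h 0 0)
      ((h 0 0 * h 2 1 - h 0 1 * h 2 0) / (h 0 0 * h 1 1 - h 0 1 * h 1 0)) *
      !![h 0 0, h 0 1, h 0 2; 0, (h 0 0 * h 1 1 - h 0 1 * h 1 0) / h 0 0,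
        (h 0 0 * h 1 2 - h 0 2 * h 1 0) / h 0 0;
        0, 0, h.det / (h 0 0 * h 1 1 - h 0 1 * h 1 0)] := by
    rw [Matrix.det_fin_three]
    ext i j
    fin_cases i <;> fin_cases j <;>
      simp [lowerUnitriangular, Matrix.mul_apply, Fin.sum_univ_three] <;> field_simp <;> ring
  exact ⟨_, _, _, _, _, _, _, _, _, h₀, div_ne_zero hdet h₁, key⟩

/-- `x y z t'` are chosen before `l` and `b`, so they serve a whole tuple at once. The value of `t'`
is the ratio of the superdiagonal entries after conjugation by the upper factor. -/
theorem exists_bigCell_conj {h : Matrix (Fin 3) (Fin 3) k} (h₀ : h 0 0 ≠ 0)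
    (h₁ : h 0 0 * h 1 1 - h 0 1 * h 1 0 ≠ 0) (hdet : h.det ≠ 0) {s : k} (hs : s ≠ 0) (t c : k) :
    ∃ x y z t', ∀ l b, ∃ l' b', c • (h * upperNilpotent s t l b * h.adjugate) =
      lowerUnitriangular x y z * upperNilpotent 1 t' l' b' * lowerUnitriangularInv x y z := by
  obtain ⟨x, y, z, p, q, u, e, w, f, hp, hf, rfl⟩ := exists_lower_mul_upper h₀ h₁ hdet
  refine ⟨x, y, z, e ^ 2 * t / (p * f * s), fun l b => ⟨c * (p ^ 2 * f * (l * s)),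
    c * (p * (p * e * b + q * e * (l * t) - p * w * (l * s))), ?_⟩⟩
  rw [Matrix.adjugate_mul_distrib, adjugate_lowerUnitriangular]
  have h₂ := upperTriangular_conj_upperNilpotent p q u e w f s t l b
  have h₃ : c • (!![p, q, u; 0, e, w; 0, 0, f] * upperNilpotent s t l b *
        !![p, q, u; 0, e, w; 0, 0, f].adjugate) =
      upperNilpotent 1 (e ^ 2 * t / (p * f * s)) (c * (p ^ 2 * f * (l * s)))
        (c * (p * (p * e * b + q * e * (l * t) - p * w * (l * s)))) := by
    rw [h₂, upperNilpotent]
    ext i j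
    fin_cases i <;> fin_cases j <;> simp
    field_simp
  rw [← h₃]
  simp only [mul_assoc, mul_smul_comm, smul_mul_assoc]

end CommutingNilpotent

/-! ### The parametrisation, its density and the strict chain. -/

section NilpotentCommutingVariety

open LieAlgebra.SpecialLinear

attribute [local instance] LieRing.ofAssociativeRing

variable {k : Type*} [Field k]

/-- The tuple of commuting trace zero matrices with entries
`L (lᵢ E₁₂ + t lᵢ E₂₃ + bᵢ E₁₃) L⁻¹`, where `L` is lower unitriangular. -/
def bigCell {r : ℕ} (b l : Fin r → k) (t z x y : k) : Fin r → sl (Fin 3) k := fun i =>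
  ⟨lowerUnitriangular x y z * upperNilpotent 1 t (l i) (b i) * lowerUnitriangularInv x y z,
    trace_conj_upperNilpotent (c := 1) (by rw [lowerUnitriangularInv_mul, one_smul]) _ _ _ _⟩

theorem bigCell_mem {r : ℕ} (b l : Fin r → k) (t z x y : k) :
    bigCell b l t z x y ∈ commutingVariety (nilpotentCone 3 k) r := by
  have hmul (M N : Matrix (Fin 3) (Fin 3) k) :
      lowerUnitriangular x y z * M * lowerUnitriangularInv x y z *
        (lowerUnitriangular x y z * N * lowerUnitriangularInv x y z) =
      lowerUnitriangular x y z * (M * N) * lowerUnitriangularInv x y z := by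
    calc _ = lowerUnitriangular x y z * M * (lowerUnitriangularInv x y z *
          lowerUnitriangular x y z) * N * lowerUnitriangularInv x y z := by simp only [mul_assoc]
      _ = _ := by rw [lowerUnitriangularInv_mul, mul_one]; simp only [mul_assoc]
  refine mem_commutingVariety_nilpotentCone_iff.2 ⟨fun i => ?_, fun i j => ?_⟩
  · change (lowerUnitriangular x y z * _ * lowerUnitriangularInv x y z) ^ 3 = 0
    have := upperNilpotent_pow 1 t (l i) (b i)
    rw [pow_succ, pow_two] at this ⊢
    rw [hmul, hmul, this, mul_zero, zero_mul]
  · change (lowerUnitriangular x y z * _ * lowerUnitriangularInv x y z) *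
      (lowerUnitriangular x y z * _ * lowerUnitriangularInv x y z) = _ * _
    rw [hmul, upperNilpotent_comm, ← hmul]
    rfl

/-- `bigCell` as a function of `2 * r + 4` coordinates. -/
def bigCellMap (r : ℕ) (p : Fin (2 * r + 4) → k) : Fin r → sl (Fin 3) k :=
  bigCell (fun i => p ⟨i, by lia⟩) (fun i => p ⟨r + i, by lia⟩) (p ⟨2 * r, by lia⟩)
    (p ⟨2 * r + 1, by lia⟩) (p ⟨2 * r + 2, by lia⟩) (p ⟨2 * r + 3, by lia⟩)

/-- The coordinates of a point of the parameter space of `bigCellMap`. -/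
def bigCellCoords {r : ℕ} (b l : Fin r → k) (t z x y : k) (i : Fin (2 * r + 4)) : k :=
  if h : (i : ℕ) < r then b ⟨i, h⟩ else
    if h : (i : ℕ) - r < r then l ⟨i - r, h⟩ else
    if (i : ℕ) = 2 * r then t else if (i : ℕ) = 2 * r + 1 then z else
    if (i : ℕ) = 2 * r + 2 then x else y

theorem bigCellMap_bigCellCoords {r : ℕ} (b l : Fin r → k) (t z x y : k) :
    bigCellMap r (bigCellCoords b l t z x y) = bigCell b l t z x y := by
  have h₀ : ¬ 2 * r < r := by lia
  have h₁ : ∀ j, ¬ 2 * r + j < r := by lia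
  have h₂ : ∀ j, ¬ 2 * r + j - r < r := by lia
  have h₃ : ¬ 2 * r - r < r := by lia
  simp [bigCellMap, bigCellCoords, h₀, h₁, h₂, h₃]

theorem upperNilpotent_entry_mem {V : Type*} [AddCommGroup V] [Module k V] {s t l b : V → k}
    (hs : s ∈ affinePolynomialFunctions k V) (ht : t ∈ affinePolynomialFunctions k V)
    (hl : l ∈ affinePolynomialFunctions k V) (hb : b ∈ affinePolynomialFunctions k V)
    (i j : Fin 3) :
    (fun v => upperNilpotent (s v) (t v) (l v) (b v) i j) ∈ affinePolynomialFunctions k V := by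
  have h0 := const_mem_affinePolynomialFunctions (V := V) (0 : k)
  fin_cases i <;> fin_cases j <;> 
    first | exact h0 | exact hb | exact mul_mem hl hs | exact mul_mem hl ht

theorem isPolynomialMap_bigCellMap (r : ℕ) : IsPolynomialMap k (bigCellMap (k := k) r) := by
  have hp (i : Fin (2 * r + 4)) : (fun p : Fin (2 * r + 4) → k => p i) ∈
      affinePolynomialFunctions k (Fin (2 * r + 4) → k) :=
    dual_mem_affinePolynomialFunctions (LinearMap.proj i : Module.Dual k (Fin (2 * r + 4) → k))
  have h0 := const_mem_affinePolynomialFunctions (V := Fin (2 * r + 4) → k) (0 : k)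
  have h1 := const_mem_affinePolynomialFunctions (V := Fin (2 * r + 4) → k) (1 : k)
  refine isPolynomialMap_sl_of_entries fun i =>
    matrix_mul_mem_affinePolynomialFunctions (matrix_mul_mem_affinePolynomialFunctions ?_
      (upperNilpotent_entry_mem h1 (hp _) (hp _) (hp _))) ?_
  · intro a b
    fin_cases a <;> fin_cases b <;> first | exact h0 | exact h1 | exact hp _
  · intro a b
    fin_cases a <;> fin_cases b <;>
      first
      | exact h0
      | exact h1
      | exact neg_mem (hp _)
      | exact sub_mem (mul_mem (hp _) (hp _)) (hp _)

theorem adjugate_entry_mem {V : Type*} [AddCommGroup V] [Module k V]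
    {M : V → Matrix (Fin 3) (Fin 3) k}
    (hM : ∀ a b, (fun v => M v a b) ∈ affinePolynomialFunctions k V) (i j : Fin 3) :
    (fun v => (M v).adjugate i j) ∈ affinePolynomialFunctions k V := by
  have h₁ (a b c d e f g h) :
      (fun v => M v a b * M v c d - M v e f * M v g h) ∈ affinePolynomialFunctions k V :=
    sub_mem (mul_mem (hM a b) (hM c d)) (mul_mem (hM e f) (hM g h))
  have h₂ (a b c d e f g h) :
      (fun v => -(M v a b * M v c d) + M v e f * M v g h) ∈ affinePolynomialFunctions k V :=
    add_mem (neg_mem (mul_mem (hM a b) (hM c d))) (mul_mem (hM e f) (hM g h))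
  simp only [Matrix.adjugate_fin_three]
  fin_cases i <;> fin_cases j <;> first | exact h₁ _ _ _ _ _ _ _ _ | exact h₂ _ _ _ _ _ _ _ _

theorem eq_smul_mul_adjugate {v g N : Matrix (Fin 3) (Fin 3) k} (hg : g.det ≠ 0)
    (h : v * g = g * N) : v = g.det⁻¹ • (g * N * g.adjugate) := by
  rw [← h, mul_assoc, Matrix.mul_adjugate, mul_smul_comm, mul_one, smul_smul, inv_mul_cancel₀ hg,
    one_smul]

/-- `bigCellMap` has dense image. -/
theorem eq_zero_of_comp_bigCellMap_eq_zero [Infinite k] {r : ℕ} {f : (Fin r → sl (Fin 3) k) → k}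
    (hf : f ∈ affinePolynomialFunctions k (Fin r → sl (Fin 3) k))
    (hf0 : ∀ p, f (bigCellMap r p) = 0) {v : Fin r → sl (Fin 3) k}
    (hv : v ∈ commutingVariety (nilpotentCone 3 k) r) : f v = 0 := by
  rw [mem_commutingVariety_nilpotentCone_iff] at hv
  obtain ⟨g, s, t, hg, hN⟩ := exists_upperNilpotent (fun i => ⟨3, hv.1 i⟩) hv.2
  choose l b hN using hN
  -- A curve through `v` at `ε = 0`. The adjugate, together with the constant `g.det⁻¹`, keeps it
  -- polynomial in `ε`.
  let γ : k → Fin r → sl (Fin 3) k := fun ε i =>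
    ⟨g.det⁻¹ • ((g + Matrix.scalar (Fin 3) ε) * upperNilpotent (s + ε) t (l i) (b i) *
      (g + Matrix.scalar (Fin 3) ε).adjugate), by
        refine LinearMap.mem_ker.2 ?_
        rw [map_smul, Matrix.traceLinearMap_apply, trace_conj_upperNilpotent
          (Matrix.adjugate_mul _), smul_zero]⟩
  have hγ0 : γ 0 = v := by
    ext1 i
    refine Subtype.ext ?_
    simp only [γ, map_zero, add_zero]
    exact (eq_smul_mul_adjugate hg (hN i)).symm
  have hid : (fun ε : k => ε) ∈ affinePolynomialFunctions k k :=
    dual_mem_affinePolynomialFunctions (LinearMap.id : Module.Dual k k)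
  have hgε (a c : Fin 3) : (fun ε => (g + Matrix.scalar (Fin 3) ε) a c) ∈
      affinePolynomialFunctions k k := by
    refine add_mem (const_mem_affinePolynomialFunctions (g a c)) ?_
    by_cases hac : a = c
    · subst hac
      simpa using hid
    · simpa [hac] using const_mem_affinePolynomialFunctions (V := k) (0 : k)
  have hγ : IsPolynomialMap k γ := isPolynomialMap_sl_of_entries fun i a c =>
    mul_mem (const_mem_affinePolynomialFunctions _)
      (matrix_mul_mem_affinePolynomialFunctions (matrix_mul_mem_affinePolynomialFunctions hgε
        (upperNilpotent_entry_mem (add_mem (const_mem_affinePolynomialFunctions s) hid)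
          (const_mem_affinePolynomialFunctions t) (const_mem_affinePolynomialFunctions _)
          (const_mem_affinePolynomialFunctions _)))
        (adjugate_entry_mem hgε) a c)
  obtain ⟨P, hP⟩ := exists_polynomial_of_mem (hγ.comp_mem hf)
  let m : Matrix (Fin 2) (Fin 2) k := !![g 0 0, g 0 1; g 1 0, g 1 1]
  -- The values at `ε` are the leading minors of `g + ε` and `s + ε`. All factors are monic, so `Q ≠
  -- 0` for every `g` and `s`; off its roots `γ ε` is in the image.
  let Q : Polynomial k := (Polynomial.X + Polynomial.C (g 0 0)) * (-m).charpoly * (-g).charpoly *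
    (Polynomial.X + Polynomial.C s)
  have hQ : Q ≠ 0 :=
    (((Polynomial.monic_X_add_C _).mul (Matrix.charpoly_monic _)).mul
      (Matrix.charpoly_monic _)).mul (Polynomial.monic_X_add_C _) |>.ne_zero
  have hPQ : P * Q = 0 := Polynomial.funext fun ε => by
    rw [Polynomial.eval_mul, Polynomial.eval_zero, ← hP, mul_eq_zero, or_iff_not_imp_right]
    intro hε
    simp only [Q, Polynomial.eval_mul, Matrix.eval_charpoly, mul_ne_zero_iff, Polynomial.eval_add,
      Polynomial.eval_X, Polynomial.eval_C, sub_neg_eq_add, ← ne_eq] at hε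
    obtain ⟨⟨⟨h₀, h₁⟩, h₂⟩, h₃⟩ := hε
    obtain ⟨x, y, z, t', H⟩ := exists_bigCell_conj (h := g + Matrix.scalar (Fin 3) ε)
      (by simpa [add_comm] using h₀)
      (by
        rw [Matrix.det_fin_two] at h₁
        simpa [m, add_comm] using h₁)
      (by rwa [add_comm]) (s := s + ε) (by rwa [add_comm]) t g.det⁻¹
    choose l' b' H using H
    have hγp : γ ε = bigCellMap r (bigCellCoords (fun i => b' (l i) (b i))
        (fun i => l' (l i) (b i)) t' z x y) := by
      rw [bigCellMap_bigCellCoords]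
      ext1 i
      exact Subtype.ext (H _ _)
    change f (γ ε) = 0
    rw [hγp, hf0]
  have hP0 : P = 0 := (mul_eq_zero.1 hPQ).resolve_right hQ
  rw [← hγ0]
  simpa [hP0] using hP 0

/-- The coordinate order `b, l, t, z, x, y` is what makes one entry enough at each stage but the
last: for example, entry `(0, 1)` is `l - b z`, which reduces to `l` while `z = 0`. For `y` the
leading `2 × 2` minor is used; it equals `l² t y`. -/
theorem bigCellMap_witness {r : ℕ} (hr : 1 ≤ r) (j : Fin (2 * r + 4)) :
    ∃ f ∈ affinePolynomialFunctions k (Fin r → sl (Fin 3) k),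
      (∀ p : Fin (2 * r + 4) → k, (∀ i, j ≤ i → p i = 0) → f (bigCellMap r p) = 0) ∧
      ∃ p : Fin (2 * r + 4) → k, (∀ i, j < i → p i = 0) ∧ f (bigCellMap r p) ≠ 0 := by
  have hent := entry_mem_affinePolynomialFunctions (k := k) (r := r) (n := Fin 3)
  have hsplit : (∃ i : Fin r, (j : ℕ) = i) ∨ (∃ i : Fin r, (j : ℕ) = r + i) ∨ (j : ℕ) = 2 * r ∨
      (j : ℕ) = 2 * r + 1 ∨ (j : ℕ) = 2 * r + 2 ∨ (j : ℕ) = 2 * r + 3 := by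
    by_cases h₁ : (j : ℕ) < r
    · exact Or.inl ⟨⟨j, h₁⟩, rfl⟩
    · by_cases h₂ : (j : ℕ) < 2 * r
      · exact Or.inr (Or.inl ⟨⟨j - r, by lia⟩, by simp only; lia⟩)
      · lia
  have hz {p : Fin (2 * r + 4) → k} (hp : ∀ i, j ≤ i → p i = 0) (m : ℕ) (hm : m < 2 * r + 4)
      (hjm : (j : ℕ) ≤ m) : p ⟨m, hm⟩ = 0 := hp _ (Fin.le_def.2 hjm)
  have hexp (f : (Fin r → sl (Fin 3) k) → k) (b l : Fin r → k) (t z x y : k)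
      (hb : ∀ i : Fin r, (j : ℕ) < i → b i = 0) (hl : ∀ i : Fin r, (j : ℕ) < r + i → l i = 0)
      (ht : (j : ℕ) < 2 * r → t = 0) (hz : (j : ℕ) < 2 * r + 1 → z = 0)
      (hx : (j : ℕ) < 2 * r + 2 → x = 0) (hy : (j : ℕ) < 2 * r + 3 → y = 0)
      (hf : f (bigCell b l t z x y) ≠ 0) :
      ∃ p : Fin (2 * r + 4) → k, (∀ i, j < i → p i = 0) ∧ f (bigCellMap r p) ≠ 0 := by
    refine ⟨bigCellCoords b l t z x y, fun i hi => ?_, by rwa [bigCellMap_bigCellCoords]⟩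
    rw [Fin.lt_def] at hi
    rw [bigCellCoords]
    split_ifs
    · exact hb _ hi
    · exact hl _ (by simp only; lia)
    · exact ht (by lia)
    · exact hz (by lia)
    · exact hx (by lia)
    · exact hy (by lia)
  have hval (b l : Fin r → k) (t z x y : k) (i : Fin r) :
      (bigCell b l t z x y i : Matrix (Fin 3) (Fin 3) k) =
        lowerUnitriangular x y z * upperNilpotent 1 t (l i) (b i) *
          lowerUnitriangularInv x y z := rfl
  -- `t, z, x, y` are shared by the whole tuple, so one matrix detects them.
  let i₀ : Fin r := ⟨0, hr⟩
  rcases hsplit with ⟨i, hi⟩ | ⟨i, hi⟩ | hj | hj | hj | hj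
  · refine ⟨_, hent i 0 2, fun p hp => ?_,
      hexp (fun w => (w i : Matrix (Fin 3) (Fin 3) k) 0 2) (Pi.single i 1) 0 0 0 0 0
        ?_ ?_ ?_ ?_ ?_ ?_ ?_⟩
    · simp [bigCellMap, hval, lowerUnitriangular, upperNilpotent, lowerUnitriangularInv,
        hz hp i (by lia) (by lia)]
    · exact fun a ha => Pi.single_eq_of_ne (by lia) _
    all_goals simp [hval, lowerUnitriangular, upperNilpotent, lowerUnitriangularInv]
  · refine ⟨_, hent i 0 1, fun p hp => ?_,
      hexp (fun w => (w i : Matrix (Fin 3) (Fin 3) k) 0 1) 0 (Pi.single i 1) 0 0 0 0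
        ?_ ?_ ?_ ?_ ?_ ?_ ?_⟩
    · simp [bigCellMap, hval, lowerUnitriangular, upperNilpotent, lowerUnitriangularInv,
        hz hp (r + i) (by lia) (by lia), hz hp (2 * r + 1) (by lia) (by lia)]
    · simp
    · exact fun a ha => Pi.single_eq_of_ne (by lia) _
    all_goals simp [hval, lowerUnitriangular, upperNilpotent, lowerUnitriangularInv]
  · refine ⟨_, hent i₀ 1 2, fun p hp => ?_,
      hexp (fun w => (w i₀ : Matrix (Fin 3) (Fin 3) k) 1 2) 0 1 1 0 0 0 ?_ ?_ ?_ ?_ ?_ ?_ ?_⟩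
    · simp [bigCellMap, hval, lowerUnitriangular, upperNilpotent, lowerUnitriangularInv,
        hz hp (2 * r) (by lia) (by lia), hz hp (2 * r + 2) (by lia) (by lia)]
    · simp
    · lia
    · lia
    all_goals simp [hval, lowerUnitriangular, upperNilpotent, lowerUnitriangularInv]
  · refine ⟨_, hent i₀ 2 1, fun p hp => ?_,
      hexp (fun w => (w i₀ : Matrix (Fin 3) (Fin 3) k) 2 1) 0 1 1 1 0 0 ?_ ?_ ?_ ?_ ?_ ?_ ?_⟩
    · simp [bigCellMap, hval, lowerUnitriangular, upperNilpotent, lowerUnitriangularInv,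
        hz hp (2 * r + 1) (by lia) (by lia), hz hp (2 * r + 3) (by lia) (by lia)]
    · simp
    · lia
    · lia
    · lia
    all_goals simp [hval, lowerUnitriangular, upperNilpotent, lowerUnitriangularInv]
  · refine ⟨_, hent i₀ 1 0, fun p hp => ?_,
      hexp (fun w => (w i₀ : Matrix (Fin 3) (Fin 3) k) 1 0) 0 1 0 0 1 0 ?_ ?_ ?_ ?_ ?_ ?_ ?_⟩
    · simp [bigCellMap, hval, lowerUnitriangular, upperNilpotent, lowerUnitriangularInv,
        hz hp (2 * r + 2) (by lia) (by lia), hz hp (2 * r + 3) (by lia) (by lia)]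
    · simp
    · lia
    · simp
    · simp
    · lia
    · simp
    · simp [hval, lowerUnitriangular, upperNilpotent, lowerUnitriangularInv]
  · refine ⟨_, sub_mem (mul_mem (hent i₀ 0 0) (hent i₀ 1 1)) (mul_mem (hent i₀ 0 1) (hent i₀ 1 0)),
      fun p hp => ?_, hexp (fun w => (w i₀ : Matrix (Fin 3) (Fin 3) k) 0 0 *
        (w i₀ : Matrix (Fin 3) (Fin 3) k) 1 1 -
        (w i₀ : Matrix (Fin 3) (Fin 3) k) 0 1 * (w i₀ : Matrix (Fin 3) (Fin 3) k) 1 0) 0 1 1 0 0 1 ?_ ?_ ?_ ?_ ?_ ?_ ?_⟩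
    · simp [bigCellMap, hval, lowerUnitriangular, upperNilpotent, lowerUnitriangularInv,
        hz hp (2 * r + 3) (by lia) (by lia)]
      ring
    · simp
    · lia
    · lia
    · simp
    · simp
    · lia
    · simp [hval, lowerUnitriangular, upperNilpotent, lowerUnitriangularInv]

end NilpotentCommutingVariety

theorem mainTheorem4 (k : Type*) [Field k] [IsAlgClosed k] (r : ℕ) (hr : 1 ≤ r) :
    IsZariskiClosed k (commutingVariety (nilpotentCone 3 k) r) ∧
      IsZariskiIrreducible k (commutingVariety (nilpotentCone 3 k) r) ∧
      zariskiDim k (commutingVariety (nilpotentCone 3 k) r) = ((2 * r + 4 : ℕ) : WithBot ℕ∞) := by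
  refine ⟨isZariskiClosed_commutingVariety_nilpotentCone 3 r, ?_, le_antisymm ?_ ?_⟩
  · let := zariskiTopology k (Fin r → LieAlgebra.SpecialLinear.sl (Fin 3) k)
    exact isIrreducible_of_dominant (k := k) (e := id) Topology.IsInducing.id
      (isPolynomialMap_bigCellMap r) (fun p => bigCell_mem _ _ _ _ _ _)
      fun f hf hf0 y hy => eq_zero_of_comp_bigCellMap_eq_zero hf hf0 hy
  · exact zariskiDim_le_of_dominant (isPolynomialMap_bigCellMap r)
      fun f hf hf0 y hy => eq_zero_of_comp_bigCellMap_eq_zero hf hf0 hy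
  · exact le_zariskiDim_of_witnesses (isPolynomialMap_bigCellMap r)
      (fun p => bigCell_mem _ _ _ _ _ _) (bigCellMap_witness hr)
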